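/- For integers $N\ge 1$ and $k,l,r\ge -1$ let $$D_N(k,l,r)=\mathbb{C}[e_1,\dots,e_N]/I_N(k,l,r),$$ where $I_N(k,l,r)$ is the ideal generated by $e_1^{\,l+1}$, $e_N^{\,r+1}$ and the elements $$\sum_{\substack{1\le\alpha_1,\dots,\alpha_{k+1}\le N\\ \alpha_1+\dots+\alpha_{k+1}=i}} e_{\alpha_1}\cdots e_{\alpha_{k+1}},\qquad k+1\le i\le N(k+1)$$ (the coefficients of $e(t)^{k+1}$, where $e(t)=\sum_{i=1}^N e_it^i$; an exponent $0$ gives the generator $1$, so that the space is zero if one of $k,l,r$ is $-1$). Bigrade $\mathbb{C}[e_1,\dots,e_N]$ by $\deg_q e_i=i$, $\deg_z e_i=1$; the ideal is bihomogeneous, so $D_N(k,l,r)$ is bigraded. It has only finitely many non-zero bihomogeneous components $D_N(k,l,r)^{i,j}$, each of finite dimension. Let $$d_N(k,l,r;q,z)=\sum_{i,j\ge 0} q^iz^j\dim D_N(k,l,r)^{i,j}\in\mathbb{Z}[q,z]$$ be its Hilbert polynomial. Then for all integers $N\ge 2$, $k$, $l\ge -1$ and $0\le r\le k+1$, $$d_N(k,l,r;q,z)=d_N(k,l,r-1;q,z)+(q^Nz)^r\,d_{N-1}(k,l,k-r;q,z).$$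 -/

import Mathlib

namespace CoinvariantSpace

open MvPolynomial

/-- The coefficient of `t ^ s` in `e(t) ^ m`, where `e(t) = e_1 t + ... + e_N t ^ N`: the sum of
`e_{α_1} ⋯ e_{α_m}` over all tuples `1 ≤ α_1, ..., α_m ≤ N` with `α_1 + ... + α_m = s`.
The variable `e_i` is `X ⟨i - 1, _⟩`. -/
noncomputable def currentCoeff (N m s : ℕ) : MvPolynomial (Fin N) ℂ :=
  ∑ α : Fin m → Fin N with ∑ j, ((α j : ℕ) + 1) = s, ∏ j, X (α j)

/-- The ideal `I_N(k,l,r)` of `ℂ[e_1, ..., e_N]` generated by `e_1 ^ (l+1)`, `e_N ^ (r+1)` and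
the coefficients of `e(t) ^ (k+1)`, for integers `k, l, r ≥ -1`. -/
noncomputable def relIdeal (N : ℕ) (k l r : ℤ) : Ideal (MvPolynomial (Fin N) ℂ) :=
  Ideal.span
    ({p | ∃ i : Fin N, (i : ℕ) + 1 = 1 ∧ p = X i ^ (l + 1).toNat} ∪
      {p | ∃ i : Fin N, (i : ℕ) + 1 = N ∧ p = X i ^ (r + 1).toNat} ∪
      {p | ∃ s : ℕ, (k + 1).toNat ≤ s ∧ s ≤ N * (k + 1).toNat ∧
        p = currentCoeff N (k + 1).toNat s})

/-- The space `D_N(k,l,r) = ℂ[e_1, ..., e_N] / I_N(k,l,r)`. -/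
abbrev D (N : ℕ) (k l r : ℤ) : Type :=
  MvPolynomial (Fin N) ℂ ⧸ relIdeal N k l r

/-- The bidegree `(deg_q, deg_z)` of the variables: `e_i` has bidegree `(i, 1)`. -/
def bideg (N : ℕ) (i : Fin N) : ℕ × ℕ := ((i : ℕ) + 1, 1)

/-- The bihomogeneous component of `D_N(k,l,r)` of bidegree `p = (deg_q, deg_z)`: the image of the
space of bihomogeneous polynomials of bidegree `p`. -/
noncomputable def component (N : ℕ) (k l r : ℤ) (p : ℕ × ℕ) : Submodule ℂ (D N k l r) :=
  (weightedHomogeneousSubmodule ℂ (bideg N) p).map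
    (Ideal.Quotient.mkₐ ℂ (relIdeal N k l r)).toLinearMap

theorem X_mem_radical (N : ℕ) (k l r : ℤ) (i : Fin N) :
    (X i : MvPolynomial (Fin N) ℂ) ∈ (relIdeal N k l r).radical := by
  obtain ⟨n, hn⟩ := i
  induction n using Nat.strong_induction_on with
  | _ n ih =>
  set m := (k + 1).toNat with hm
  have hg : currentCoeff N m ((n + 1) * m) ∈ relIdeal N k l r := by
    refine Ideal.subset_span (Or.inr ⟨(n + 1) * m, ?_, ?_, rfl⟩)
    · exact Nat.le_mul_of_pos_left _ (Nat.succ_pos _)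
    · exact Nat.mul_le_mul_right _ hn
  have hc : (fun _ : Fin m => (⟨n, hn⟩ : Fin N)) ∈
      Finset.univ.filter (fun α : Fin m → Fin N => ∑ j, ((α j : ℕ) + 1) = (n + 1) * m) := by
    simp [mul_comm]
  have hsum := hg
  rw [currentCoeff, ← Finset.add_sum_erase _ _ hc] at hsum
  have hrest : ∑ α ∈ (Finset.univ.filter
      (fun α : Fin m → Fin N => ∑ j, ((α j : ℕ) + 1) = (n + 1) * m)).erase
        (fun _ => (⟨n, hn⟩ : Fin N)), ∏ j, (X (α j) : MvPolynomial (Fin N) ℂ)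
      ∈ (relIdeal N k l r).radical := by
    refine Ideal.sum_mem _ fun α hα => ?_
    rw [Finset.mem_erase, Finset.mem_filter] at hα
    obtain ⟨hne, -, hs⟩ := hα
    have hex : ∃ j, (α j : ℕ) < n := by
      by_contra! hcon
      apply hne
      have heq : ∑ j : Fin m, (n + 1) = ∑ j, ((α j : ℕ) + 1) := by
        rw [hs]; simp [mul_comm]
      have := (Finset.sum_eq_sum_iff_of_le
        (fun j _ => Nat.succ_le_succ (hcon j))).1 heq
      funext j
      have hj := this j (Finset.mem_univ j)
      exact Fin.ext (by simpa using hj.symm)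
    obtain ⟨j, hj⟩ := hex
    exact Ideal.mem_of_dvd _ (Finset.dvd_prod_of_mem _ (Finset.mem_univ j))
      (ih (α j) hj (α j).isLt)
  have hpow : (X ⟨n, hn⟩ : MvPolynomial (Fin N) ℂ) ^ m ∈ (relIdeal N k l r).radical := by
    have := (Submodule.add_mem_iff_left _ hrest).1 (Ideal.le_radical hsum)
    simpa using this
  exact Ideal.radical_isRadical _ ⟨m, hpow⟩

/-- Only finitely many bihomogeneous components of `D_N(k,l,r)` are non-zero. -/
theorem finite_support (N : ℕ) (k l r : ℤ) :
    {p : ℕ × ℕ | component N k l r p ≠ ⊥}.Finite := by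
  have hle : idealOfVars (Fin N) ℂ ≤ (relIdeal N k l r).radical := by
    refine Ideal.span_le.2 ?_
    rintro _ ⟨i, rfl⟩
    exact X_mem_radical N k l r i
  obtain ⟨n, hn⟩ := Ideal.exists_pow_le_of_le_radical_of_fg hle
    (IsNoetherian.noetherian _)
  refine (Set.finite_Iic ((N * n, n) : ℕ × ℕ)).subset ?_
  rintro ⟨a, b⟩ hp
  by_contra hcon
  apply hp
  rw [component, eq_bot_iff, Submodule.map_le_iff_le_comap]
  intro f hf
  have hw : ∀ d : Fin N →₀ ℕ, coeff d f ≠ 0 → a ≤ N * b ∧ d.degree = b := by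
    intro d hd
    have h := hf hd
    rw [Finsupp.weight_apply, Finsupp.sum_fintype _ _ (by simp)] at h
    have h1 := congrArg Prod.fst h
    have h2 := congrArg Prod.snd h
    simp only [Prod.fst_sum, Prod.snd_sum, Prod.smul_fst, Prod.smul_snd, bideg,
      smul_eq_mul, mul_one] at h1 h2
    refine ⟨?_, by rw [Finsupp.degree_eq_sum]; exact h2⟩
    rw [← h1, ← h2, Finset.mul_sum]
    refine Finset.sum_le_sum fun i _ => ?_
    rw [mul_comm]
    exact Nat.mul_le_mul_right _ i.isLt
  have hmem : f ∈ relIdeal N k l r := by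
    by_cases hf0 : f = 0
    · rw [hf0]; exact zero_mem _
    apply hn
    rw [mem_pow_idealOfVars_iff']
    intro d hd
    by_contra hne
    obtain ⟨h1, h2⟩ := hw d hne
    apply hcon
    have hb : b ≤ n := by omega
    exact ⟨h1.trans (Nat.mul_le_mul_left _ hb), hb⟩
  simpa using Ideal.Quotient.eq_zero_iff_mem.2 hmem

/-- The indeterminate `q` of `ℤ[q, z]`. -/
noncomputable def q : MvPolynomial (Fin 2) ℤ := X 0

/-- The indeterminate `z` of `ℤ[q, z]`. -/
noncomputable def z : MvPolynomial (Fin 2) ℤ := X 1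

/-- The Hilbert polynomial `d_N(k,l,r;q,z) = ∑ q ^ i z ^ j dim D_N(k,l,r)^{i,j}`, the sum being
over the finitely many bidegrees `(i, j)` with non-zero component. -/
noncomputable def hilbertPoly (N : ℕ) (k l r : ℤ) : MvPolynomial (Fin 2) ℤ :=
  ∑ p ∈ (finite_support N k l r).toFinset,
    (Module.finrank ℂ (component N k l r p) : MvPolynomial (Fin 2) ℤ) * (q ^ p.1 * z ^ p.2)

end CoinvariantSpace

namespace CoinvariantSpace

open MvPolynomial

/-! Put `K = k+1`, `L = l+1`, `R = r+1`. For `N ≥ 1` the classes of the monomials `e^a` with `a_i +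
a_{i+1} < K`, `a_i < K`, `a_1 < L`, `a_N < R` form a basis of the quotient. The Hilbert polynomial
is therefore a generating function over such exponents, and the recursion sorts them by whether the
last exponent is smaller than `r` or equal to `r`.

Spanning (`mk_monomial_mem_span`) is straightening. In each coefficient of `e(t)^K`, a monomial in
two neighbouring variables has strictly smaller convex weight `∑ a_i i^2` than all the others, so it
can be rewritten in terms of heavier ones; the weight is bounded in a fixed bidegree.

Independence (`linearIndependent_mk_monomial`) comes from linear forms that kill the ideal and are
triangular with respect to the convex weight (`exists_isLeading`). For `K = 2` such a form is, in
the dual picture of symmetric polynomials, a product of two alternants: it vanishes on the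
diagonals, which is orthogonality to `e(t)^2`, and the rearrangement inequality finds its leading
monomial. For larger `K` the forms are multiplied along `e_i ↦ e_i ⊗ 1 + 1 ⊗ e_i`
(`exists_isLeading_add`), after an admissible exponent is cut into 0-1 exponents without adjacent
ones (`exists_nonadjacent_le`). -/

/-! ### The ideal and the powers of the current -/

/-- The ideal `I_N(K-1,L-1,R-1)`, indexed by the exponents of its generators. -/
noncomputable def powIdeal (N K L R : ℕ) : Ideal (MvPolynomial (Fin N) ℂ) :=
  Ideal.span
    ({p | ∃ i : Fin N, (i : ℕ) + 1 = 1 ∧ p = X i ^ L} ∪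
      {p | ∃ i : Fin N, (i : ℕ) + 1 = N ∧ p = X i ^ R} ∪
      {p | ∃ s : ℕ, K ≤ s ∧ s ≤ N * K ∧ p = currentCoeff N K s})

theorem relIdeal_eq_powIdeal (N : ℕ) (k l r : ℤ) :
    relIdeal N k l r = powIdeal N (k + 1).toNat (l + 1).toNat (r + 1).toNat := rfl

/-- The current `∑ x_i t ^ (i + 1)` with coefficients in a commutative ring. -/
noncomputable def current {N : ℕ} {A : Type*} [CommRing A] (x : Fin N → A) : Polynomial A :=
  ∑ i : Fin N, Polynomial.C (x i) * Polynomial.X ^ ((i : ℕ) + 1)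

theorem coeff_current_pow {N : ℕ} {A : Type*} [CommRing A] (x : Fin N → A) (m s : ℕ) :
    (current x ^ m).coeff s =
      ∑ α : Fin m → Fin N with ∑ j, ((α j : ℕ) + 1) = s, ∏ j, x (α j) := by
  rw [current, Fintype.sum_pow, Polynomial.finsetSum_coeff, Finset.sum_filter]
  refine Finset.sum_congr rfl fun α _ => ?_
  rw [Finset.prod_mul_distrib, Finset.prod_pow_eq_pow_sum, ← map_prod,
    Polynomial.coeff_C_mul_X_pow]
  simp only [eq_comm]

theorem map_currentCoeff {N : ℕ} {A : Type*} [CommRing A] [Algebra ℂ A]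
    (φ : MvPolynomial (Fin N) ℂ →ₐ[ℂ] A) (m s : ℕ) :
    φ (currentCoeff N m s) = (current (fun i => φ (X i)) ^ m).coeff s := by
  rw [coeff_current_pow, currentCoeff, map_sum]
  simp only [map_prod]

theorem currentCoeff_eq_zero {N m s : ℕ} (h : ¬ (m ≤ s ∧ s ≤ N * m)) :
    currentCoeff N m s = 0 := by
  rw [currentCoeff, Finset.filter_eq_empty_iff.2, Finset.sum_empty]
  rintro α - rfl
  apply h
  constructor
  · simpa using Finset.card_nsmul_le_sum Finset.univ (fun j => ((α j : ℕ) + 1)) 1 (by simp)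
  · have := Finset.sum_le_card_nsmul Finset.univ (fun j => ((α j : ℕ) + 1)) N
      (fun j _ => (α j).isLt)
    simpa [mul_comm] using this

/-- Outside the range of degrees used for the generators the coefficient is zero. The relations thus
amount to the single identity `e(t)^K = 0` over the quotient. -/
theorem currentCoeff_mem (N K L R s : ℕ) : currentCoeff N K s ∈ powIdeal N K L R := by
  by_cases h : K ≤ s ∧ s ≤ N * K
  · exact Ideal.subset_span (Or.inr ⟨s, h.1, h.2, rfl⟩)
  · rw [currentCoeff_eq_zero h]
    exact zero_mem _

theorem X_first_pow_mem {N : ℕ} (K L R : ℕ) (i : Fin N) (hi : (i : ℕ) = 0) :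
    X i ^ L ∈ powIdeal N K L R :=
  Ideal.subset_span (Or.inl (Or.inl ⟨i, by omega, rfl⟩))

theorem X_last_pow_mem {N : ℕ} (K L R : ℕ) (i : Fin N) (hi : (i : ℕ) + 1 = N) :
    X i ^ R ∈ powIdeal N K L R :=
  Ideal.subset_span (Or.inl (Or.inr ⟨i, hi, rfl⟩))

theorem powIdeal_le_ker {N K L R : ℕ} {A : Type*} [CommRing A] [Algebra ℂ A]
    (φ : MvPolynomial (Fin N) ℂ →ₐ[ℂ] A) (hK : current (fun i => φ (X i)) ^ K = 0)
    (hL : ∀ i : Fin N, (i : ℕ) = 0 → φ (X i) ^ L = 0)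
    (hR : ∀ i : Fin N, (i : ℕ) + 1 = N → φ (X i) ^ R = 0) :
    powIdeal N K L R ≤ RingHom.ker φ := by
  refine Ideal.span_le.2 ?_
  rintro p ((⟨i, hi, rfl⟩ | ⟨i, hi, rfl⟩) | ⟨s, -, -, rfl⟩)
  · simpa using hL i (by omega)
  · simpa using hR i hi
  · simp [RingHom.mem_ker, map_currentCoeff, hK]

/-! ### Leading forms and their products -/

/-- The convex weight `∑ a_i (i + 1) ^ 2` of an exponent. -/
noncomputable def sqWeight {N : ℕ} : (Fin N →₀ ℕ) →+ ℕ :=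
  Finsupp.weight fun i : Fin N => ((i : ℕ) + 1) ^ 2

/-- A linear form that is non-zero on the monomial `e ^ a` and vanishes on all other monomials of
at least the same convex weight. -/
def IsLeading {N : ℕ} (ψ : MvPolynomial (Fin N) ℂ →ₗ[ℂ] ℂ) (a : Fin N →₀ ℕ) : Prop :=
  ψ (monomial a 1) ≠ 0 ∧ ∀ b, b ≠ a → sqWeight a ≤ sqWeight b → ψ (monomial b 1) = 0

theorem monomial_one_eq_prod {N : ℕ} (b : Fin N →₀ ℕ) :
    (monomial b (1 : ℂ)) = ∏ i, X i ^ b i := by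
  rw [monomial_eq, map_one, one_mul, Finsupp.prod_fintype _ _ (by simp)]

/-- If `x^(m+1) = 0` and `y^(n+1) = 0`, every binomial term of `(x+y)^(m+n+1)` vanishes. This
applies to the two currents over `A[t]` and to the images of the first and last variables. -/
theorem powIdeal_le_ker_add {N K₁ L₁ R₁ K₂ L₂ R₂ : ℕ} {A : Type*} [CommRing A] [Algebra ℂ A]
    {f g φ : MvPolynomial (Fin N) ℂ →ₐ[ℂ] A} (hφ : ∀ i, φ (X i) = f (X i) + g (X i))
    (hf : powIdeal N (K₁ + 1) (L₁ + 1) (R₁ + 1) ≤ RingHom.ker f)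
    (hg : powIdeal N (K₂ + 1) (L₂ + 1) (R₂ + 1) ≤ RingHom.ker g) :
    powIdeal N (K₁ + K₂ + 1) (L₁ + L₂ + 1) (R₁ + R₂ + 1) ≤ RingHom.ker φ := by
  have hcur : current (fun i => φ (X i)) =
      current (fun i => f (X i)) + current (fun i => g (X i)) := by
    simp [current, hφ, add_mul, Finset.sum_add_distrib]
  refine powIdeal_le_ker φ ?_ ?_ ?_
  · rw [hcur]
    refine (Commute.all _ _).add_pow_eq_zero_of_add_le_succ_of_pow_eq_zero
      (m := K₁ + 1) (n := K₂ + 1) ?_ ?_ (by omega)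
    · ext s
      rw [← map_currentCoeff]
      simpa using hf (currentCoeff_mem _ _ _ _ s)
    · ext s
      rw [← map_currentCoeff]
      simpa using hg (currentCoeff_mem _ _ _ _ s)
  · intro i hi
    rw [hφ]
    refine (Commute.all _ _).add_pow_eq_zero_of_add_le_succ_of_pow_eq_zero
      (m := L₁ + 1) (n := L₂ + 1) ?_ ?_ (by omega)
    · rw [← map_pow]
      exact hf (X_first_pow_mem _ _ _ i hi)
    · rw [← map_pow]
      exact hg (X_first_pow_mem _ _ _ i hi)
  · intro i hi
    rw [hφ]
    refine (Commute.all _ _).add_pow_eq_zero_of_add_le_succ_of_pow_eq_zero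
      (m := R₁ + 1) (n := R₂ + 1) ?_ ?_ (by omega)
    · rw [← map_pow]
      exact hf (X_last_pow_mem _ _ _ i hi)
    · rw [← map_pow]
      exact hg (X_last_pow_mem _ _ _ i hi)

/-- The value on `e^c` expands over the splittings `c = b₁ + b₂` with positive binomial
coefficients. The convex weight is additive, so if `c` is at least as heavy as `a₁ + a₂`, then `b₁`
is at least as heavy as `a₁` or `b₂` is strictly heavier than `a₂`. Only the splitting `(a₁, a₂)`
survives. -/
theorem isLeading_add {N : ℕ} {a₁ a₂ : Fin N →₀ ℕ} {A : Type*} [CommRing A] [Algebra ℂ A]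
    {f g φ : MvPolynomial (Fin N) ℂ →ₐ[ℂ] A} (hφ : ∀ i, φ (X i) = f (X i) + g (X i))
    {ψ₁ ψ₂ : MvPolynomial (Fin N) ℂ →ₗ[ℂ] ℂ} {Ψ : A →ₗ[ℂ] ℂ}
    (hΨ : ∀ P Q, Ψ (f P * g Q) = ψ₁ P * ψ₂ Q)
    (hψ₁ : IsLeading ψ₁ a₁) (hψ₂ : IsLeading ψ₂ a₂) :
    IsLeading (Ψ ∘ₗ φ.toLinearMap) (a₁ + a₂) := by
  have hexp : ∀ c : Fin N →₀ ℕ, Ψ (φ (monomial c 1)) =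
      ∑ e ∈ Fintype.piFinset fun i => Finset.HasAntidiagonal.antidiagonal (c i),
        (∏ i, ((c i).choose (e i).1 : ℂ)) *
          (ψ₁ (monomial (Finsupp.equivFunOnFinite.symm fun i => (e i).1) 1) *
            ψ₂ (monomial (Finsupp.equivFunOnFinite.symm fun i => (e i).2) 1)) := by
    intro c
    rw [monomial_one_eq_prod, map_prod]
    have : ∀ i, φ (X i ^ c i) = ∑ p ∈ Finset.HasAntidiagonal.antidiagonal (c i),
        algebraMap ℂ _ ((c i).choose p.1 : ℂ) * (f (X i ^ p.1) * g (X i ^ p.2)) := by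
      intro i
      rw [map_pow, hφ, (Commute.all _ _).add_pow']
      refine Finset.sum_congr rfl fun p _ => ?_
      simp [nsmul_eq_mul]
    rw [Finset.prod_congr rfl fun i _ => this i, Finset.prod_univ_sum, map_sum]
    refine Finset.sum_congr rfl fun e _ => ?_
    simp only [Finset.prod_mul_distrib, ← map_prod]
    rw [← Algebra.smul_def, map_smul, hΨ, monomial_one_eq_prod, monomial_one_eq_prod]
    simp
  refine ⟨?_, ?_⟩
  · change Ψ (φ (monomial (a₁ + a₂) 1)) ≠ 0
    rw [hexp, Finset.sum_eq_single fun i => (a₁ i, a₂ i)]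
    · refine mul_ne_zero (Finset.prod_ne_zero_iff.2 fun i _ => ?_) ?_
      · exact_mod_cast (Nat.choose_pos (by simp)).ne'
      · convert mul_ne_zero hψ₁.1 hψ₂.1 <;> ext <;> simp
    · intro e he hne
      set b₁ : Fin N →₀ ℕ := Finsupp.equivFunOnFinite.symm fun i => (e i).1 with hb₁
      set b₂ : Fin N →₀ ℕ := Finsupp.equivFunOnFinite.symm fun i => (e i).2 with hb₂
      have hsum : b₁ + b₂ = a₁ + a₂ := by
        ext i
        simpa [hb₁, hb₂] using Fintype.mem_piFinset.1 he i
      have hw := congrArg sqWeight hsum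
      rw [map_add, map_add] at hw
      by_cases hle : sqWeight a₁ ≤ sqWeight b₁
      · by_cases heq : b₁ = a₁
        · exfalso
          apply hne
          have heq₂ : b₂ = a₂ := by
            rw [heq] at hsum
            exact add_left_cancel hsum
          funext i
          rw [← heq, ← heq₂]
          rfl
        · rw [hψ₁.2 _ heq hle, zero_mul, mul_zero]
      · have hlt : sqWeight a₂ < sqWeight b₂ := by omega
        have hne₂ : b₂ ≠ a₂ := by
          rintro h
          rw [h] at hlt
          exact lt_irrefl _ hlt
        rw [hψ₂.2 _ hne₂ hlt.le, mul_zero, mul_zero]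
    · intro h
      exact absurd (Fintype.mem_piFinset.2 fun i => by simp) h
  · intro c hc hle
    change Ψ (φ (monomial c 1)) = 0
    rw [hexp]
    refine Finset.sum_eq_zero fun e he => ?_
    set b₁ : Fin N →₀ ℕ := Finsupp.equivFunOnFinite.symm fun i => (e i).1 with hb₁
    set b₂ : Fin N →₀ ℕ := Finsupp.equivFunOnFinite.symm fun i => (e i).2 with hb₂
    have hsum : b₁ + b₂ = c := by
      ext i
      simpa [hb₁, hb₂] using Fintype.mem_piFinset.1 he i
    rw [← hsum, map_add, map_add] at hle
    by_cases heq : b₁ = a₁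
    · have hne₂ : b₂ ≠ a₂ := by
        rintro h
        exact hc (by rw [← hsum, heq, h])
      rw [heq] at hle
      rw [hψ₂.2 _ hne₂ (by omega), mul_zero, mul_zero]
    · by_cases hle₁ : sqWeight a₁ ≤ sqWeight b₁
      · rw [hψ₁.2 _ heq hle₁, zero_mul, mul_zero]
      · have hlt : sqWeight a₂ < sqWeight b₂ := by omega
        have hne₂ : b₂ ≠ a₂ := by
          rintro h
          rw [h] at hlt
          exact lt_irrefl _ hlt
        rw [hψ₂.2 _ hne₂ hlt.le, mul_zero, mul_zero]

theorem exists_isLeading_add_of_algHom {N K₁ L₁ R₁ K₂ L₂ R₂ : ℕ} {a₁ a₂ : Fin N →₀ ℕ}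
    {ψ₁ ψ₂ : MvPolynomial (Fin N) ℂ →ₗ[ℂ] ℂ} (hψ₁ : IsLeading ψ₁ a₁) (hψ₂ : IsLeading ψ₂ a₂)
    {A : Type*} [CommRing A] [Algebra ℂ A] (f g : MvPolynomial (Fin N) ℂ →ₐ[ℂ] A)
    (hf : powIdeal N (K₁ + 1) (L₁ + 1) (R₁ + 1) ≤ RingHom.ker f)
    (hg : powIdeal N (K₂ + 1) (L₂ + 1) (R₂ + 1) ≤ RingHom.ker g)
    (Ψ : A →ₗ[ℂ] ℂ) (hΨ : ∀ P Q, Ψ (f P * g Q) = ψ₁ P * ψ₂ Q) :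
    ∃ ψ : MvPolynomial (Fin N) ℂ →ₗ[ℂ] ℂ,
      (∀ P ∈ powIdeal N (K₁ + K₂ + 1) (L₁ + L₂ + 1) (R₁ + R₂ + 1), ψ P = 0) ∧
        IsLeading ψ (a₁ + a₂) := by
  let φ : MvPolynomial (Fin N) ℂ →ₐ[ℂ] A := aeval fun i => f (X i) + g (X i)
  have hφ : ∀ i, φ (X i) = f (X i) + g (X i) := fun i => aeval_X _ _
  refine ⟨_, fun P hP => ?_, isLeading_add hφ hΨ hψ₁ hψ₂⟩
  have : φ P = 0 := powIdeal_le_ker_add hφ hf hg hP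
  rw [LinearMap.comp_apply, AlgHom.toLinearMap_apply, this, map_zero]

-- The common target is the tensor product of the two quotients, with the form `ψ₁ ⊗ ψ₂` and the map
-- `e_i ↦ e_i ⊗ 1 + 1 ⊗ e_i`.
open scoped TensorProduct in
theorem exists_isLeading_add {N K₁ L₁ R₁ K₂ L₂ R₂ : ℕ} {a₁ a₂ : Fin N →₀ ℕ}
    {ψ₁ ψ₂ : MvPolynomial (Fin N) ℂ →ₗ[ℂ] ℂ}
    (h₁ : ∀ P ∈ powIdeal N (K₁ + 1) (L₁ + 1) (R₁ + 1), ψ₁ P = 0) (hψ₁ : IsLeading ψ₁ a₁)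
    (h₂ : ∀ P ∈ powIdeal N (K₂ + 1) (L₂ + 1) (R₂ + 1), ψ₂ P = 0) (hψ₂ : IsLeading ψ₂ a₂) :
    ∃ ψ : MvPolynomial (Fin N) ℂ →ₗ[ℂ] ℂ,
      (∀ P ∈ powIdeal N (K₁ + K₂ + 1) (L₁ + L₂ + 1) (R₁ + R₂ + 1), ψ P = 0) ∧
        IsLeading ψ (a₁ + a₂) := by
  set I₁ := powIdeal N (K₁ + 1) (L₁ + 1) (R₁ + 1)
  set I₂ := powIdeal N (K₂ + 1) (L₂ + 1) (R₂ + 1)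
  let χ₁ : MvPolynomial (Fin N) ℂ ⧸ I₁ →ₗ[ℂ] ℂ := (I₁.restrictScalars ℂ).liftQ ψ₁ h₁
  let χ₂ : MvPolynomial (Fin N) ℂ ⧸ I₂ →ₗ[ℂ] ℂ := (I₂.restrictScalars ℂ).liftQ ψ₂ h₂
  refine exists_isLeading_add_of_algHom hψ₁ hψ₂
    (A := (MvPolynomial (Fin N) ℂ ⧸ I₁) ⊗[ℂ] (MvPolynomial (Fin N) ℂ ⧸ I₂))
    (Algebra.TensorProduct.includeLeft.comp (Ideal.Quotient.mkₐ ℂ I₁))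
    (Algebra.TensorProduct.includeRight.comp (Ideal.Quotient.mkₐ ℂ I₂)) ?_ ?_
    (LinearMap.mul' ℂ ℂ ∘ₗ TensorProduct.map χ₁ χ₂) ?_
  · intro P hP
    have h : Ideal.Quotient.mk I₁ P = 0 := Ideal.Quotient.eq_zero_iff_mem.2 hP
    simp [RingHom.mem_ker, h]
  · intro P hP
    have h : Ideal.Quotient.mk I₂ P = 0 := Ideal.Quotient.eq_zero_iff_mem.2 hP
    simp [RingHom.mem_ker, h]
  · intro P Q
    simp only [AlgHom.comp_apply, Algebra.TensorProduct.includeLeft_apply,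
      Algebra.TensorProduct.includeRight_apply, Algebra.TensorProduct.tmul_mul_tmul, mul_one,
      one_mul]
    rfl

/-! ### Leading forms for the square of the current -/

/-- The homomorphism sending `e_i` to the sum of the variables `ε_p` with `g p = i`. -/
noncomputable def fiberSum {m N : ℕ} (g : Fin m → Fin N) :
    MvPolynomial (Fin N) ℂ →ₐ[ℂ] MvPolynomial (Fin m) ℂ :=
  aeval fun i => ∑ p with g p = i, X p

theorem fiberSum_X {m N : ℕ} (g : Fin m → Fin N) (i : Fin N) :
    fiberSum g (X i) = ∑ p with g p = i, X p := aeval_X _ _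

/-- The ideal generated by the squares of the variables. -/
noncomputable def sqIdeal (m : ℕ) : Ideal (MvPolynomial (Fin m) ℂ) :=
  Ideal.span (Set.range fun p => X p * X p)

/-- The coefficient of the product of all the variables. -/
noncomputable def topCoeff (m : ℕ) : MvPolynomial (Fin m) ℂ →ₗ[ℂ] ℂ :=
  lcoeff ℂ (∑ p, Finsupp.single p 1)

theorem topCoeff_eq_zero {m : ℕ} {P : MvPolynomial (Fin m) ℂ} (hP : P ∈ sqIdeal m) :
    topCoeff m P = 0 := by
  suffices h : ∀ Q, topCoeff m (Q * P) = 0 by simpa using h 1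
  refine Submodule.span_induction (p := fun P _ => ∀ Q, topCoeff m (Q * P) = 0)
    ?_ (by simp) ?_ ?_ hP
  · rintro _ ⟨p, rfl⟩ Q
    have hp : (∑ x : Fin m, Finsupp.single x 1 : Fin m →₀ ℕ) p = 1 := by
      simp [Finsupp.finsetSum_apply, Finsupp.single_apply]
    rw [topCoeff, lcoeff_apply, ← mul_assoc, coeff_mul_X', coeff_mul_X']
    simp [hp]
  · intro x y _ _ hx hy Q
    rw [mul_add, map_add, hx, hy, add_zero]
  · intro a x _ hx Q
    rw [smul_eq_mul, ← mul_assoc]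
    exact hx _

/-- Modulo squares, the factor `ε_p ε_{p'}` kills every further occurrence of `ε_p` and `ε_{p'}`, so
the positions assigned to `p` and `p'` no longer matter. -/
theorem X_mul_X_mul_fiberSum_sub_mem {m N : ℕ} {g g' : Fin m → Fin N} {p p' : Fin m}
    (h : ∀ x, x ≠ p → x ≠ p' → g x = g' x) (P : MvPolynomial (Fin N) ℂ) :
    X p * X p' * fiberSum g P - X p * X p' * fiberSum g' P ∈ sqIdeal m := by
  have hsq : ∀ x : Fin m, Ideal.Quotient.mk (sqIdeal m) (X x) *
      Ideal.Quotient.mk (sqIdeal m) (X x) = 0 := fun x => by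
    rw [← map_mul]
    exact Ideal.Quotient.eq_zero_iff_mem.2 (Ideal.subset_span ⟨x, rfl⟩)
  rw [← Ideal.Quotient.eq]
  induction P using MvPolynomial.induction_on with
  | C a => simp [fiberSum]
  | add P Q hP hQ => simp only [map_add, mul_add, hP, hQ]
  | mul_X P i hP =>
    have hX : Ideal.Quotient.mk (sqIdeal m) (X p * X p' * fiberSum g (X i)) =
        Ideal.Quotient.mk (sqIdeal m) (X p * X p' * fiberSum g' (X i)) := by
      simp only [fiberSum_X, Finset.mul_sum, map_sum, Finset.sum_filter]
      refine Finset.sum_congr rfl fun x _ => ?_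
      by_cases hx : x = p
      · subst hx
        have : Ideal.Quotient.mk (sqIdeal m) (X x * X p' * X x) = 0 := by
          rw [map_mul, map_mul, mul_right_comm, hsq, zero_mul]
        split_ifs <;> simp [-map_mul, this]
      by_cases hx' : x = p'
      · subst hx'
        have : Ideal.Quotient.mk (sqIdeal m) (X p * X x * X x) = 0 := by
          rw [map_mul, map_mul, mul_assoc, hsq, mul_zero]
        split_ifs <;> simp [-map_mul, this]
      rw [h x hx hx']
    calc Ideal.Quotient.mk (sqIdeal m) (X p * X p' * fiberSum g (P * X i))
        = Ideal.Quotient.mk (sqIdeal m) (X p * X p' * fiberSum g P) *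
            Ideal.Quotient.mk (sqIdeal m) (fiberSum g (X i)) := by
          simp only [map_mul]; ring
      _ = Ideal.Quotient.mk (sqIdeal m) (X p * X p' * fiberSum g (X i)) *
            Ideal.Quotient.mk (sqIdeal m) (fiberSum g' P) := by
          rw [hP]; simp only [map_mul]; ring
      _ = Ideal.Quotient.mk (sqIdeal m) (X p * X p' * fiberSum g' (P * X i)) := by
          rw [hX]; simp only [map_mul]; ring

theorem current_fiberSum {m N : ℕ} (g : Fin m → Fin N) :
    current (fun i => fiberSum g (X i)) =
      ∑ p, Polynomial.C (X p) * Polynomial.X ^ ((g p : ℕ) + 1) := by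
  simp only [current, fiberSum_X, map_sum, Finset.sum_mul, Finset.sum_filter]
  rw [Finset.sum_comm]
  refine Finset.sum_congr rfl fun p _ => ?_
  rw [Finset.sum_eq_single (g p)]
  · simp
  · intro i _ hi
    simp [hi.symm]
  · simp

theorem fiberSum_currentCoeff_two {m N : ℕ} (g : Fin m → Fin N) (s : ℕ) :
    fiberSum g (currentCoeff N 2 s) =
      ∑ p, ∑ p', if s = (g p : ℕ) + 1 + ((g p' : ℕ) + 1) then X p * X p' else 0 := by
  rw [map_currentCoeff, current_fiberSum, sq, Finset.sum_mul_sum, Polynomial.finsetSum_coeff]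
  refine Finset.sum_congr rfl fun p _ => ?_
  rw [Polynomial.finsetSum_coeff]
  refine Finset.sum_congr rfl fun p' _ => ?_
  rw [mul_mul_mul_comm, ← map_mul, ← pow_add, Polynomial.coeff_C_mul_X_pow]

/-- The antisymmetrization over `ρ` of the coefficients of `∏ e_{pos ρ p}`. -/
noncomputable def signedForm {m N : ℕ} (pos : Equiv.Perm (Fin m) → Fin m → Fin N) :
    MvPolynomial (Fin N) ℂ →ₗ[ℂ] ℂ :=
  ∑ ρ : Equiv.Perm (Fin m),
    ((Equiv.Perm.sign ρ : ℤ) : ℂ) • (topCoeff m ∘ₗ (fiberSum (pos ρ)).toLinearMap)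

theorem signedForm_apply {m N : ℕ} (pos : Equiv.Perm (Fin m) → Fin m → Fin N)
    (P : MvPolynomial (Fin N) ℂ) :
    signedForm pos P = ∑ ρ : Equiv.Perm (Fin m),
      ((Equiv.Perm.sign ρ : ℤ) : ℂ) * topCoeff m (fiberSum (pos ρ) P) := by
  simp [signedForm]

/-- Fix the two indices `p ≠ p'` that take part in the quadratic relation. Replacing `ρ` by `ρ *
swap p p'` keeps the sum of the two positions and all other positions, and reverses the sign, so the
terms cancel in pairs. -/
theorem signedForm_mul_currentCoeff {m N : ℕ} {lam mu : Fin m → ℕ}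
    {pos : Equiv.Perm (Fin m) → Fin m → Fin N} (hpos : ∀ ρ p, (pos ρ p : ℕ) = lam p + mu (ρ p))
    (P : MvPolynomial (Fin N) ℂ) (s : ℕ) : signedForm pos (P * currentCoeff N 2 s) = 0 := by
  have key : ∀ p p' : Fin m, ∑ ρ : Equiv.Perm (Fin m), ((Equiv.Perm.sign ρ : ℤ) : ℂ) *
      (if s = (pos ρ p : ℕ) + 1 + ((pos ρ p' : ℕ) + 1) then
        topCoeff m (X p * X p' * fiberSum (pos ρ) P) else 0) = 0 := by
    intro p p'
    by_cases hp : p = p'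
    · subst hp
      refine Finset.sum_eq_zero fun ρ _ => ?_
      rw [topCoeff_eq_zero (Ideal.mul_mem_right _ _ (Ideal.subset_span ⟨p, rfl⟩)), ite_self,
        mul_zero]
    refine Finset.sum_involution (fun ρ _ => ρ * Equiv.swap p p') ?_ ?_ (by simp) ?_
    · intro ρ _
      have hs : (pos (ρ * Equiv.swap p p') p : ℕ) + 1 + ((pos (ρ * Equiv.swap p p') p' : ℕ) + 1) =
          (pos ρ p : ℕ) + 1 + ((pos ρ p' : ℕ) + 1) := by
        simp only [hpos, Equiv.Perm.mul_apply, Equiv.swap_apply_left, Equiv.swap_apply_right]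
        omega
      have ht : topCoeff m (X p * X p' * fiberSum (pos (ρ * Equiv.swap p p')) P) =
          topCoeff m (X p * X p' * fiberSum (pos ρ) P) := by
        rw [← sub_eq_zero, ← map_sub]
        refine topCoeff_eq_zero (X_mul_X_mul_fiberSum_sub_mem (fun x hx hx' => ?_) P)
        apply Fin.ext
        rw [hpos, hpos, Equiv.Perm.mul_apply, Equiv.swap_apply_of_ne_of_ne hx hx']
      rw [hs, ht, Equiv.Perm.sign_mul, Equiv.Perm.sign_swap hp]
      simp only [mul_neg, mul_one, Units.val_neg, Int.cast_neg, neg_mul, add_neg_cancel]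
    · intro ρ _ _ h
      rw [mul_eq_left, Equiv.swap_eq_one_iff] at h
      exact hp h
    · intro ρ _
      rw [mul_assoc, Equiv.swap_mul_self, mul_one]
  calc signedForm pos (P * currentCoeff N 2 s)
      = ∑ ρ : Equiv.Perm (Fin m), ∑ p, ∑ p', ((Equiv.Perm.sign ρ : ℤ) : ℂ) *
          (if s = (pos ρ p : ℕ) + 1 + ((pos ρ p' : ℕ) + 1) then
            topCoeff m (X p * X p' * fiberSum (pos ρ) P) else 0) := by
        rw [signedForm_apply]
        refine Finset.sum_congr rfl fun ρ _ => ?_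
        rw [mul_comm P, map_mul, fiberSum_currentCoeff_two]
        simp only [Finset.sum_mul, map_sum, Finset.mul_sum, ite_mul, zero_mul,
          apply_ite (topCoeff m), map_zero]
    _ = ∑ p, ∑ p', ∑ ρ : Equiv.Perm (Fin m), ((Equiv.Perm.sign ρ : ℤ) : ℂ) *
          (if s = (pos ρ p : ℕ) + 1 + ((pos ρ p' : ℕ) + 1) then
            topCoeff m (X p * X p' * fiberSum (pos ρ) P) else 0) := by
        rw [Finset.sum_comm]
        exact Finset.sum_congr rfl fun p _ => Finset.sum_comm
    _ = 0 := Finset.sum_eq_zero fun p _ => Finset.sum_eq_zero fun p' _ => key p p'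

theorem signedForm_mul_X {m N : ℕ} {pos : Equiv.Perm (Fin m) → Fin m → Fin N} {i : Fin N}
    (h : ∀ ρ p, pos ρ p ≠ i) (P : MvPolynomial (Fin N) ℂ) : signedForm pos (P * X i) = 0 := by
  rw [signedForm_apply]
  refine Finset.sum_eq_zero fun ρ _ => ?_
  rw [map_mul, fiberSum_X, Finset.filter_false_of_mem fun p _ => h ρ p]
  simp

theorem X_first_sq {N : ℕ} (i : Fin N) (hi : (i : ℕ) = 0) : X i ^ 2 = currentCoeff N 2 2 := by
  rw [currentCoeff, Finset.sum_eq_single fun _ => i]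
  · simp
  · intro α hα hne
    refine absurd ?_ hne
    have := (Finset.mem_filter.1 hα).2
    rw [Fin.sum_univ_two] at this
    funext j
    apply Fin.ext
    fin_cases j <;> simp <;> omega
  · intro h
    simp [hi] at h

theorem X_last_sq {N : ℕ} (i : Fin N) (hi : (i : ℕ) + 1 = N) :
    X i ^ 2 = currentCoeff N 2 (2 * N) := by
  rw [currentCoeff, Finset.sum_eq_single fun _ => i]
  · simp
  · intro α hα hne
    refine absurd ?_ hne
    have := (Finset.mem_filter.1 hα).2
    rw [Fin.sum_univ_two] at this
    have h0 := (α 0).isLt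
    have h1 := (α 1).isLt
    funext j
    apply Fin.ext
    fin_cases j <;> simp <;> omega
  · intro h
    simp [hi, two_mul] at h

/-- The squares of the first and last variables are themselves coefficients of `e(t)^2`. An end
condition is therefore new only when its exponent is 1, and then it suffices that no position is
that end. -/
theorem signedForm_eq_zero {m N L R : ℕ} {lam mu : Fin m → ℕ}
    {pos : Equiv.Perm (Fin m) → Fin m → Fin N} (hpos : ∀ ρ p, (pos ρ p : ℕ) = lam p + mu (ρ p))
    (hL : ∀ i : Fin N, (i : ℕ) = 0 → 1 ≤ L ∨ ∀ ρ p, pos ρ p ≠ i)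
    (hR : ∀ i : Fin N, (i : ℕ) + 1 = N → 1 ≤ R ∨ ∀ ρ p, pos ρ p ≠ i)
    (P : MvPolynomial (Fin N) ℂ) (hP : P ∈ powIdeal N 2 (L + 1) (R + 1)) :
    signedForm pos P = 0 := by
  suffices h : ∀ Q, signedForm pos (Q * P) = 0 by simpa using h 1
  refine Submodule.span_induction (p := fun P _ => ∀ Q, signedForm pos (Q * P) = 0)
    ?_ (by simp) ?_ ?_ hP
  · rintro p ((⟨i, hi, rfl⟩ | ⟨i, hi, rfl⟩) | ⟨s, -, -, rfl⟩) Q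
    · rcases hL i (by omega) with h | h
      · obtain ⟨L, rfl⟩ := Nat.exists_eq_add_of_le h
        rw [show 1 + L + 1 = L + 2 by omega, pow_add, X_first_sq i (by omega), ← mul_assoc]
        exact signedForm_mul_currentCoeff hpos _ _
      · rw [pow_succ, ← mul_assoc]
        exact signedForm_mul_X h _
    · rcases hR i hi with h | h
      · obtain ⟨R, rfl⟩ := Nat.exists_eq_add_of_le h
        rw [show 1 + R + 1 = R + 2 by omega, pow_add, X_last_sq i hi, ← mul_assoc]
        exact signedForm_mul_currentCoeff hpos _ _
      · rw [pow_succ, ← mul_assoc]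
        exact signedForm_mul_X h _
    · exact signedForm_mul_currentCoeff hpos _ _
  · intro x y _ _ hx hy Q
    rw [mul_add, map_add, hx, hy, add_zero]
  · intro a x _ hx Q
    rw [smul_eq_mul, ← mul_assoc]
    exact hx _

/-- Giving `ε_p` the multidegree of `e_{g p}` makes `fiberSum g` multihomogeneous, and the product
of all `ε_p` occurs in only one multidegree. -/
theorem eq_of_topCoeff_fiberSum_ne_zero {m N : ℕ} {g : Fin m → Fin N} {b : Fin N →₀ ℕ}
    (h : topCoeff m (fiberSum g (monomial b 1)) ≠ 0) : b = ∑ p, Finsupp.single (g p) 1 := by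
  have hX : ∀ i, IsWeightedHomogeneous (fun p => Finsupp.single (g p) 1) (fiberSum g (X i))
      (Finsupp.single i 1 : Fin N →₀ ℕ) := by
    intro i
    rw [fiberSum_X]
    refine IsWeightedHomogeneous.sum _ _ _ fun p hp => ?_
    rw [← (Finset.mem_filter.1 hp).2]
    exact isWeightedHomogeneous_X _ _ _
  have hb : IsWeightedHomogeneous (fun p => Finsupp.single (g p) 1) (fiberSum g (monomial b 1))
      (∑ i, b i • Finsupp.single i 1 : Fin N →₀ ℕ) := by
    rw [monomial_one_eq_prod, map_prod]
    refine IsWeightedHomogeneous.prod _ _ _ fun i _ => ?_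
    rw [map_pow]
    exact (hX i).pow _
  have := hb h
  rw [map_sum] at this
  have hsum : (∑ i, b i • Finsupp.single i 1 : Fin N →₀ ℕ) = b := by
    simp
  rw [hsum] at this
  simpa [Finsupp.weight_single] using this.symm

theorem topCoeff_fiberSum_of_injective {m N : ℕ} {g : Fin m → Fin N}
    (hg : Function.Injective g) :
    topCoeff m (fiberSum g (monomial (∑ p, Finsupp.single (g p) 1) 1)) = 1 := by
  have h1 : (monomial (∑ p, Finsupp.single (g p) 1) (1 : ℂ)) = ∏ p, X (g p) := by
    simp [X, monomial_sum_one]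
  have h2 : ∀ p, fiberSum g (X (g p)) = X p := by
    intro p
    rw [fiberSum_X]
    simp [hg.eq_iff, Finset.filter_eq']
  rw [h1, map_prod, Finset.prod_congr rfl fun p _ => h2 p]
  have h3 : (∏ p, X p : MvPolynomial (Fin m) ℂ) = monomial (∑ p, Finsupp.single p 1) 1 := by
    rw [monomial_sum_one]
    rfl
  rw [h3, topCoeff, lcoeff_apply, coeff_monomial, if_pos rfl]

theorem sqWeight_sum_single {m N : ℕ} (g : Fin m → Fin N) :
    sqWeight (∑ p, Finsupp.single (g p) 1) = ∑ p, ((g p : ℕ) + 1) ^ 2 := by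
  simp [sqWeight, Finsupp.weight_single]

/-- In `∑ (lam p + mu (ρ p) + 1)^2` only the cross term `2 ∑ lam p * mu (ρ p)` depends on `ρ`. By
the rearrangement inequality for strictly increasing sequences it is largest at the identity alone.
-/
theorem sqWeight_lt_of_ne_one {m N : ℕ} {lam mu : Fin m → ℕ} (hlam : StrictMono lam)
    (hmu : StrictMono mu)
    {pos : Equiv.Perm (Fin m) → Fin m → Fin N} (hpos : ∀ ρ p, (pos ρ p : ℕ) = lam p + mu (ρ p))
    {ρ : Equiv.Perm (Fin m)} (hρ : ρ ≠ 1) :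
    sqWeight (∑ p, Finsupp.single (pos ρ p) 1) < sqWeight (∑ p, Finsupp.single (pos 1 p) 1) := by
  have hmono : Monovary lam mu := (hlam.monotone.monovary hmu.monotone)
  have hlt : ∑ p, lam p * mu (ρ p) < ∑ p, lam p * mu p := by
    refine hmono.sum_mul_comp_perm_lt_sum_mul_iff.2 fun h => hρ ?_
    have hmon : StrictMono ρ := by
      refine Monotone.strictMono_of_injective ?_ ρ.injective
      intro x y hxy
      by_contra! hlt
      rcases hxy.lt_or_eq with hxy | rfl
      · exact absurd (h (hmu hlt)) (not_le.2 (hlam hxy))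
      · exact lt_irrefl _ hlt
    ext x
    -- The only order automorphism of a finite chain is the identity.
    have := Subsingleton.elim (hmon.orderIsoOfSurjective ρ ρ.surjective) (OrderIso.refl _)
    simpa using congrArg (fun e => ((e x : Fin m) : ℕ)) this
  have h2 : ∑ p, (mu (ρ p) + 1) ^ 2 = ∑ p, (mu p + 1) ^ 2 := Equiv.sum_comp ρ fun p => (mu p + 1) ^ 2
  rw [sqWeight_sum_single, sqWeight_sum_single]
  have h3 : ∀ ρ : Equiv.Perm (Fin m), ∑ p, ((pos ρ p : ℕ) + 1) ^ 2 =
      ∑ p, lam p ^ 2 + 2 * ∑ p, lam p + 2 * ∑ p, lam p * mu (ρ p) + ∑ p, (mu (ρ p) + 1) ^ 2 := by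
    intro ρ
    simp only [Finset.mul_sum, ← Finset.sum_add_distrib, hpos]
    exact Finset.sum_congr rfl fun p _ => by ring
  rw [h3, h3, h2]
  simp only [Equiv.Perm.one_apply]
  omega

theorem isLeading_signedForm {m N : ℕ} {lam mu : Fin m → ℕ} (hlam : StrictMono lam)
    (hmu : StrictMono mu)
    {pos : Equiv.Perm (Fin m) → Fin m → Fin N}
    (hpos : ∀ ρ p, (pos ρ p : ℕ) = lam p + mu (ρ p)) :
    IsLeading (signedForm pos) (∑ p, Finsupp.single (pos 1 p) 1) := by
  have hinj : Function.Injective (pos 1) := by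
    refine StrictMono.injective fun x y hxy => ?_
    rw [Fin.lt_def, hpos, hpos]
    exact add_lt_add (hlam hxy) (hmu hxy)
  constructor
  · rw [signedForm_apply, Finset.sum_eq_single 1]
    · simp [topCoeff_fiberSum_of_injective hinj]
    · intro ρ _ hρ
      rw [mul_eq_zero]
      right
      by_contra h
      have := sqWeight_lt_of_ne_one hlam hmu hpos hρ
      rw [← eq_of_topCoeff_fiberSum_ne_zero h] at this
      exact lt_irrefl _ this
    · simp
  · intro b hb hle
    rw [signedForm_apply]
    refine Finset.sum_eq_zero fun ρ _ => ?_
    rw [mul_eq_zero]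
    right
    by_contra h
    have hb' := eq_of_topCoeff_fiberSum_ne_zero h
    by_cases hρ : ρ = 1
    · subst hρ
      exact hb hb'
    · have := sqWeight_lt_of_ne_one hlam hmu hpos hρ
      rw [← hb'] at this
      omega

theorem exists_isLeading_of_nonadjacent {N L R : ℕ} (S : Fin N →₀ ℕ) (h1 : ∀ i, S i ≤ 1)
    (h2 : ∀ i j : Fin N, (j : ℕ) = i + 1 → S i + S j ≤ 1)
    (hL : ∀ i : Fin N, (i : ℕ) = 0 → S i ≤ L) (hR : ∀ i : Fin N, (i : ℕ) + 1 = N → S i ≤ R) :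
    ∃ ψ : MvPolynomial (Fin N) ℂ →ₗ[ℂ] ℂ,
      (∀ P ∈ powIdeal N 2 (L + 1) (R + 1), ψ P = 0) ∧ IsLeading ψ S := by
  obtain ⟨m, hm⟩ : ∃ m, S.support.card = m := ⟨_, rfl⟩
  let s : Fin m ↪o Fin N := S.support.orderEmbOfFin hm
  have hs : ∀ p, S (s p) = 1 := by
    intro p
    have := Finsupp.mem_support_iff.1 (S.support.orderEmbOfFin_mem hm p)
    have := h1 (s p)
    simp only [s] at *
    omega
  have hgap : ∀ p p' : Fin m, p < p' → (s p : ℕ) + 2 ≤ s p' := by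
    intro p p' hp
    have hlt : (s p : ℕ) < s p' := s.lt_iff_lt.2 hp
    by_contra hcon
    have := h2 (s p) (s p') (by omega)
    rw [hs, hs] at this
    omega
  have hgap' : ∀ d : ℕ, ∀ p p' : Fin m, (p' : ℕ) = p + d → (s p : ℕ) + 2 * d ≤ s p' := by
    intro d
    induction d with
    | zero =>
      intro p p' h
      rw [Fin.ext (a := p') (b := p) (by simpa using h)]
      simp
    | succ d ih =>
      intro p p' h
      have hlt := p'.isLt
      have h3 := ih p ⟨p + d, by omega⟩ rfl
      have h4 := hgap ⟨p + d, by omega⟩ p' (Fin.lt_def.2 (by simp; omega))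
      omega
  have hle : ∀ p : Fin m, (p : ℕ) ≤ s p := by
    intro p
    have := hgap' p ⟨0, p.pos⟩ p (by simp)
    omega
  -- The sorted support is split as `s_p = p + (s_p - p)`; the second summand is strictly increasing
  -- because the support has gaps of at least 2.
  let lam : Fin m → ℕ := fun p => p
  let mu : Fin m → ℕ := fun p => s p - p
  have hlam : StrictMono lam := fun p p' h => h
  have hmu : StrictMono mu := by
    intro p p' h
    have h3 : (p : ℕ) < p' := h
    have h4 := hgap' (p' - p) p p' (by omega)
    have h5 := hle p
    simp only [mu]
    omega
  -- All positions `lam p + mu x` lie between the first and the last element of the support. They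
  -- stay in range, and they reach an end of `Fin N` only if the support contains that end.
  have hub : ∀ p x : Fin m, ∃ t : Fin m, lam p + mu x ≤ s t := by
    intro p x
    have hp := p.isLt
    have hx := hmu.monotone (show x ≤ ⟨m - 1, by omega⟩ from Fin.le_def.2 (by simp; omega))
    have h3 := hle ⟨m - 1, by omega⟩
    refine ⟨⟨m - 1, by omega⟩, ?_⟩
    simp only [mu, lam] at *
    omega
  have hlb : ∀ p x : Fin m, ∃ t : Fin m, s t ≤ lam p + mu x := by
    intro p x
    have hx := hmu.monotone (show (⟨0, p.pos⟩ : Fin m) ≤ x from Fin.le_def.2 (by simp))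
    refine ⟨⟨0, p.pos⟩, ?_⟩
    simp only [mu, lam] at *
    omega
  let pos : Equiv.Perm (Fin m) → Fin m → Fin N := fun ρ p => ⟨lam p + mu (ρ p), by
    obtain ⟨t, ht⟩ := hub p (ρ p)
    exact ht.trans_lt (s t).isLt⟩
  have hpos : ∀ ρ p, (pos ρ p : ℕ) = lam p + mu (ρ p) := fun _ _ => rfl
  have hS : S = ∑ p, Finsupp.single (pos 1 p) 1 := by
    have h3 : ∀ p, pos 1 p = s p := by
      intro p
      apply Fin.ext
      have := hle p
      simp only [pos, lam, mu, Equiv.Perm.one_apply]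
      omega
    simp only [h3]
    ext i
    rw [Finsupp.finsetSum_apply]
    by_cases hi : i ∈ S.support
    · obtain ⟨p, rfl⟩ : ∃ p, s p = i := by
        have : i ∈ Set.range s := by
          rw [Finset.range_orderEmbOfFin]
          exact hi
        exact this
      rw [hs]
      simp [Finsupp.single_apply]
    · rw [Finsupp.notMem_support_iff.1 hi, Finset.sum_eq_zero]
      intro p _
      rw [Finsupp.single_apply, if_neg]
      rintro rfl
      exact hi (S.support.orderEmbOfFin_mem hm p)
  refine ⟨signedForm pos, signedForm_eq_zero hpos ?_ ?_, hS ▸ isLeading_signedForm hlam hmu hpos⟩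
  · intro i hi
    by_cases h : ∃ ρ p, pos ρ p = i
    · left
      obtain ⟨ρ, p, rfl⟩ := h
      obtain ⟨t, ht⟩ := hlb p (ρ p)
      rw [hpos] at hi
      have := hL (s t) (by omega)
      rwa [hs] at this
    · push Not at h
      exact Or.inr h
  · intro i hi
    by_cases h : ∃ ρ p, pos ρ p = i
    · left
      obtain ⟨ρ, p, rfl⟩ := h
      obtain ⟨t, ht⟩ := hub p (ρ p)
      rw [hpos] at hi
      have := hR (s t) (by have := (s t).isLt; omega)
      rwa [hs] at this
    · push Not at h
      exact Or.inr h

/-! ### Leading forms for all powers of the current -/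

theorem div_le_add_div_and {K x y : ℕ} (hK : 0 < K) (hy : y ≤ K) :
    x / K ≤ (x + y) / K ∧ (x + y) / K ≤ x / K + 1 ∧ (y = K → (x + y) / K = x / K + 1) := by
  refine ⟨Nat.div_le_div_right (by omega), ?_, ?_⟩
  · rw [← Nat.add_div_right _ hK]
    exact Nat.div_le_div_right (by omega)
  · rintro rfl
    exact Nat.add_div_right _ hK

/-- An exponent with adjacent sums at most `k + 1` dominates a 0-1 exponent without adjacent ones
whose removal makes the adjacent sums at most `k`. -/
theorem exists_nonadjacent_le {N k : ℕ} (a : Fin N →₀ ℕ) (h1 : ∀ i, a i ≤ k + 1)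
    (h2 : ∀ i j : Fin N, (j : ℕ) = i + 1 → a i + a j ≤ k + 1) :
    ∃ S : Fin N →₀ ℕ, S ≤ a ∧ (∀ i, S i ≤ 1) ∧
      (∀ i j : Fin N, (j : ℕ) = i + 1 → S i + S j ≤ 1) ∧ (∀ i, a i ≤ S i + k) ∧
      (∀ i j : Fin N, (j : ℕ) = i + 1 → a i + a j ≤ S i + S j + k) := by
  let c : ℕ → ℕ := fun n => ∑ i ∈ Finset.univ.filter (fun i : Fin N => (i : ℕ) < n), a i
  have hc : ∀ i : Fin N, c (i + 1) = c i + a i := by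
    intro i
    have : (Finset.univ.filter fun j : Fin N => (j : ℕ) < i + 1) =
        insert i (Finset.univ.filter fun j : Fin N => (j : ℕ) < i) := by
      ext j
      simp only [Finset.mem_filter, Finset.mem_univ, true_and, Finset.mem_insert, Fin.ext_iff]
      omega
    simp only [c]
    rw [this, Finset.sum_insert (by simp), add_comm]
  -- `S i` counts the multiples of `k + 1` in `(c i, c (i + 1)]`, where `c` is the sequence of
  -- partial sums of `a`. A block of total at most `k + 1` contains at most one multiple, and
  -- exactly one if its total is `k + 1`.
  let S : Fin N →₀ ℕ :=
    Finsupp.equivFunOnFinite.symm fun i => c (i + 1) / (k + 1) - c i / (k + 1)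
  have hS : ∀ i, S i = (c i + a i) / (k + 1) - c i / (k + 1) := by
    intro i
    rw [← hc]
    rfl
  have hone := fun i : Fin N => div_le_add_div_and (x := c i) k.add_one_pos (h1 i)
  have htwo : ∀ i j : Fin N, (j : ℕ) = i + 1 →
      S i + S j = (c i + (a i + a j)) / (k + 1) - c i / (k + 1) := by
    intro i j hij
    have hi := hone i
    have hj := hone j
    rw [hS, hS, hij, hc, ← add_assoc]
    rw [hij, hc] at hj
    omega
  refine ⟨S, fun i => ?_, fun i => ?_, fun i j hij => ?_, fun i => ?_, fun i j hij => ?_⟩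
  · have := hone i
    rcases Nat.eq_zero_or_pos (a i) with h | h
    · rw [hS, h]
      simp
    · rw [hS]
      omega
  · have := hone i
    rw [hS]
    omega
  · have := div_le_add_div_and (x := c i) k.add_one_pos (h2 i j hij)
    rw [htwo i j hij]
    omega
  · have := hone i
    have := h1 i
    rw [hS]
    omega
  · have := div_le_add_div_and (x := c i) k.add_one_pos (h2 i j hij)
    have := h2 i j hij
    rw [htwo i j hij]
    omega

/-- Induction on `k`: a non-adjacent 0-1 exponent `S` is split off from `a`, and the forms for `a -
S` and `S` are multiplied. For `k = 0` the form is evaluation at the origin. -/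
theorem exists_isLeading {N : ℕ} (k : ℕ) : ∀ (L R : ℕ) (a : Fin N →₀ ℕ), (∀ i, a i ≤ k) →
    (∀ i j : Fin N, (j : ℕ) = i + 1 → a i + a j ≤ k) →
    (∀ i : Fin N, (i : ℕ) = 0 → a i ≤ L) → (∀ i : Fin N, (i : ℕ) + 1 = N → a i ≤ R) →
    ∃ ψ : MvPolynomial (Fin N) ℂ →ₗ[ℂ] ℂ,
      (∀ P ∈ powIdeal N (k + 1) (L + 1) (R + 1), ψ P = 0) ∧ IsLeading ψ a := by
  induction k with
  | zero =>
    intro L R a h1 _ _ _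
    have ha : a = 0 := by
      ext i
      simpa using h1 i
    subst ha
    let φ : MvPolynomial (Fin N) ℂ →ₐ[ℂ] ℂ := aeval fun _ => 0
    have hφ : ∀ i, φ (X i) = 0 := fun i => aeval_X _ _
    refine ⟨φ.toLinearMap, fun P hP => ?_, ?_, ?_⟩
    · refine powIdeal_le_ker φ ?_ ?_ ?_ hP
      · simp [current, hφ]
      · intro i _
        rw [hφ, zero_pow (by omega)]
      · intro i _
        rw [hφ, zero_pow (by omega)]
    · simp [φ]
    · intro b hb _
      obtain ⟨i, hi⟩ := Finsupp.ne_iff.1 hb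
      rw [AlgHom.toLinearMap_apply, monomial_one_eq_prod, map_prod]
      refine Finset.prod_eq_zero (Finset.mem_univ i) ?_
      rw [map_pow, hφ, zero_pow (by simpa using hi)]
  | succ k ih =>
    intro L R a h1 h2 hL hR
    obtain ⟨S, hSa, hS1, hS2, hS3, hS4⟩ := exists_nonadjacent_le a h1 h2
    -- Each end bound is shared between the two factors as `(B - S i) + S i` at the end `i`. When
    -- there are no variables, any sharing will do.
    have hsplit : ∀ (B : ℕ) (p : Fin N → Prop), (∀ i j, p i → p j → i = j) →
        (∀ i, p i → a i ≤ B) →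
        ∃ B₁ B₂, B₁ + B₂ = B ∧ (∀ i, p i → (a - S) i ≤ B₁) ∧ (∀ i, p i → S i ≤ B₂) := by
      intro B p hp hB
      by_cases h : ∃ i, p i
      · obtain ⟨i, hi⟩ := h
        have h3 := hB i hi
        have h4 := hSa i
        refine ⟨B - S i, S i, by omega, fun j hj => ?_, fun j hj => ?_⟩
        · rw [hp j i hj hi, Finsupp.tsub_apply]
          omega
        · rw [hp j i hj hi]
      · push Not at h
        exact ⟨B, 0, rfl, fun i hi => absurd hi (h i), fun i hi => absurd hi (h i)⟩
    obtain ⟨L₁, L₂, rfl, hL₁, hL₂⟩ :=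
      hsplit L (fun i => (i : ℕ) = 0) (fun i j hi hj => Fin.ext (hi.trans hj.symm)) hL
    obtain ⟨R₁, R₂, rfl, hR₁, hR₂⟩ :=
      hsplit R (fun i => (i : ℕ) + 1 = N) (fun i j hi hj => Fin.ext (by omega)) hR
    obtain ⟨ψ₁, hk₁, hψ₁⟩ := ih L₁ R₁ (a - S)
      (fun i => by have := hS3 i; rw [Finsupp.tsub_apply]; omega)
      (fun i j hij => by
        have h3 := hS4 i j hij
        have h4 := hSa i
        have h5 := hSa j
        rw [Finsupp.tsub_apply, Finsupp.tsub_apply]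
        omega) hL₁ hR₁
    obtain ⟨ψ₂, hk₂, hψ₂⟩ := exists_isLeading_of_nonadjacent S hS1 hS2 hL₂ hR₂
    have := exists_isLeading_add (K₂ := 1) hk₁ hψ₁ hk₂ hψ₂
    rwa [tsub_add_cancel_of_le hSa] at this

/-! ### Linear independence of the admissible monomials -/

/-- The exponents of the basis monomials of the quotient by `powIdeal N K L R`. -/
def IsAdmissible (N K L R : ℕ) (a : Fin N →₀ ℕ) : Prop :=
  (∀ i, a i < K) ∧ (∀ i j : Fin N, (j : ℕ) = i + 1 → a i + a j < K) ∧
    (∀ i : Fin N, (i : ℕ) = 0 → a i < L) ∧ (∀ i : Fin N, (i : ℕ) + 1 = N → a i < R)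

theorem finite_isAdmissible (N K L R : ℕ) : {a | IsAdmissible N K L R a}.Finite := by
  refine (Set.finite_Iic (Finsupp.equivFunOnFinite.symm fun _ : Fin N => K)).subset ?_
  intro a ha i
  exact (ha.1 i).le

/-- In a non-trivial relation, take the lightest exponent with non-zero coefficient. Its leading
form kills the ideal and all the other terms, but not this one. -/
theorem linearIndependent_mk_monomial {N : ℕ} (hN : 1 ≤ N) (K L R : ℕ) :
    LinearIndependent ℂ fun a : {a // IsAdmissible N K L R a} =>
      (Ideal.Quotient.mkₐ ℂ (powIdeal N K L R)) (monomial a.1 1) := by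
  classical
  rw [linearIndependent_iff']
  intro s c hc
  by_contra! hcon
  obtain ⟨a, ha, hmin⟩ := (s.filter fun a => c a ≠ 0).exists_min_image (fun a => sqWeight a.1) (by
    obtain ⟨i, hi, hi'⟩ := hcon
    exact ⟨i, Finset.mem_filter.2 ⟨hi, hi'⟩⟩)
  obtain ⟨has, hca⟩ := Finset.mem_filter.1 ha
  obtain ⟨h1, h2, h3, h4⟩ := a.2
  -- As there is at least one variable, the strict bounds on `a` force `K`, `L` and `R` to be
  -- positive.
  obtain ⟨k, rfl⟩ := Nat.exists_eq_succ_of_ne_zero (h1 ⟨0, hN⟩).ne_bot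
  obtain ⟨l, rfl⟩ := Nat.exists_eq_succ_of_ne_zero (h3 ⟨0, hN⟩ rfl).ne_bot
  obtain ⟨r, rfl⟩ := Nat.exists_eq_succ_of_ne_zero
    (h4 ⟨N - 1, by omega⟩ (Nat.sub_add_cancel hN)).ne_bot
  obtain ⟨ψ, hψ, hlead⟩ := exists_isLeading k l r a.1 (fun i => Nat.lt_succ_iff.1 (h1 i))
    (fun i j hij => Nat.lt_succ_iff.1 (h2 i j hij)) (fun i hi => Nat.lt_succ_iff.1 (h3 i hi))
    (fun i hi => Nat.lt_succ_iff.1 (h4 i hi))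
  have hmem : ∑ b ∈ s, c b • monomial b.1 (1 : ℂ) ∈ powIdeal N (k + 1) (l + 1) (r + 1) := by
    rw [← Ideal.Quotient.eq_zero_iff_mem, ← Ideal.Quotient.mkₐ_eq_mk ℂ, map_sum]
    simpa only [map_smul] using hc
  have h0 := hψ _ hmem
  rw [map_sum, Finset.sum_eq_single_of_mem a has] at h0
  · rw [map_smul, smul_eq_mul] at h0
    exact mul_ne_zero hca hlead.1 h0
  · intro b hb hba
    by_cases hcb : c b = 0
    · rw [hcb, zero_smul, map_zero]
    · rw [map_smul, hlead.2 b.1 (fun h => hba (Subtype.ext h))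
        (hmin b (Finset.mem_filter.2 ⟨hb, hcb⟩)), smul_zero]

/-! ### Spanning by straightening -/

/-- Among the products of `K` variables of a given degree, the ones in two neighbouring variables
have the smallest convex weight, and at most one product is of this kind. -/
theorem sum_single_eq_or_sqWeight_lt {N K v : ℕ} {α β : Fin K → Fin N}
    (hβ : ∀ j, (β j : ℕ) = v ∨ (β j : ℕ) = v + 1)
    (hs : ∑ j, ((α j : ℕ) + 1) = ∑ j, ((β j : ℕ) + 1)) :
    (∑ j, Finsupp.single (α j) 1 : Fin N →₀ ℕ) = ∑ j, Finsupp.single (β j) 1 ∨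
      sqWeight (∑ j, Finsupp.single (β j) 1) < sqWeight (∑ j, Finsupp.single (α j) 1) := by
  have hs' : ∑ j, (α j : ℤ) = ∑ j, (β j : ℤ) := by
    have : ((∑ j, ((α j : ℕ) + 1) : ℕ) : ℤ) = ((∑ j, ((β j : ℕ) + 1) : ℕ) : ℤ) := by rw [hs]
    push_cast at this
    simpa [Finset.sum_add_distrib] using this
  -- `(x - v)(x - v - 1)` differs from `(x + 1)^2` by an affine function of `x`, whose sum is fixed
  -- by the degree. On integers it is non-negative, and it vanishes only at `v` and `v + 1`.
  have hnn : ∀ x : ℤ, 0 ≤ (x - v) * (x - v - 1) := by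
    intro x
    rcases le_or_gt x v with h | h
    · exact mul_nonneg_of_nonpos_of_nonpos (by omega) (by omega)
    · exact mul_nonneg (by omega) (by omega)
  have hexp : ∀ γ : Fin K → Fin N, ((sqWeight (∑ j, Finsupp.single (γ j) 1) : ℕ) : ℤ) =
      ∑ j, ((γ j : ℤ) - v) * ((γ j : ℤ) - v - 1) + (2 * v + 3) * ∑ j, (γ j : ℤ) +
        K * (1 - v * (v + 1)) := by
    intro γ
    rw [sqWeight_sum_single]
    push_cast
    have : (K : ℤ) * (1 - v * (v + 1)) = ∑ _j : Fin K, ((1 : ℤ) - v * (v + 1)) := by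
      rw [Finset.sum_const, Finset.card_univ, Fintype.card_fin, nsmul_eq_mul]
    rw [this, Finset.mul_sum, ← Finset.sum_add_distrib, ← Finset.sum_add_distrib]
    exact Finset.sum_congr rfl fun j _ => by ring
  have hβ0 : ∑ j, ((β j : ℤ) - v) * ((β j : ℤ) - v - 1) = 0 := by
    refine Finset.sum_eq_zero fun j _ => ?_
    rcases hβ j with h | h <;> rw [h] <;> push_cast <;> ring
  by_cases hα0 : ∑ j, ((α j : ℤ) - v) * ((α j : ℤ) - v - 1) = 0
  · left
    rw [Finset.sum_eq_zero_iff_of_nonneg fun j _ => hnn _] at hα0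
    have hα : ∀ j, (α j : ℕ) = v ∨ (α j : ℕ) = v + 1 := by
      intro j
      rcases mul_eq_zero.1 (hα0 j (Finset.mem_univ j)) with h | h <;> omega
    -- For `K` numbers in `{v, v + 1}` the sum determines both multiplicities.
    have hcount : ∀ γ : Fin K → Fin N, (∀ j, (γ j : ℕ) = v ∨ (γ j : ℕ) = v + 1) → ∀ i : Fin N,
        (((∑ j, Finsupp.single (γ j) 1 : Fin N →₀ ℕ) i : ℕ) : ℤ) =
          if (i : ℕ) = v then K * (v + 1) - ∑ j, (γ j : ℤ) else
            if (i : ℕ) = v + 1 then ∑ j, (γ j : ℤ) - K * v else 0 := by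
      intro γ hγ i
      have hK1 : (K : ℤ) * (v + 1) = ∑ _j : Fin K, ((v : ℤ) + 1) := by simp
      have hK2 : (K : ℤ) * v = ∑ _j : Fin K, (v : ℤ) := by simp
      rw [hK1, hK2, ← Finset.sum_sub_distrib, ← Finset.sum_sub_distrib, Finsupp.finsetSum_apply]
      push_cast
      split_ifs with h h'
      · refine Finset.sum_congr rfl fun j _ => ?_
        simp only [Finsupp.single_apply, Fin.ext_iff]
        rcases hγ j with h1 | h1
        · rw [if_pos (by omega)]
          omega
        · rw [if_neg (by omega)]
          omega
      · refine Finset.sum_congr rfl fun j _ => ?_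
        simp only [Finsupp.single_apply, Fin.ext_iff]
        rcases hγ j with h1 | h1
        · rw [if_neg (by omega)]
          omega
        · rw [if_pos (by omega)]
          omega
      · refine Finset.sum_eq_zero fun j _ => ?_
        simp only [Finsupp.single_apply, Fin.ext_iff]
        rcases hγ j with h1 | h1 <;> rw [if_neg (by omega)] <;> rfl
    ext i
    have h1 := hcount α hα i
    have h2 := hcount β hβ i
    rw [hs', ← h2] at h1
    exact_mod_cast h1
  · right
    have hpos : 0 < ∑ j, ((α j : ℤ) - v) * ((α j : ℤ) - v - 1) :=
      lt_of_le_of_ne (Finset.sum_nonneg fun j _ => hnn _) (Ne.symm hα0)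
    have h1 := hexp α
    have h2 := hexp β
    rw [hs'] at h1
    omega

theorem weight_bideg_sum_single {N K : ℕ} (α : Fin K → Fin N) :
    Finsupp.weight (bideg N) (∑ j, Finsupp.single (α j) 1) = (∑ j, ((α j : ℕ) + 1), K) := by
  simp only [map_sum, Finsupp.weight_single, one_smul, bideg]
  ext
  · simp [Prod.fst_sum]
  · simp [Prod.snd_sum]

theorem exists_sum_single_le {N K : ℕ} {b : Fin N →₀ ℕ}
    (h : (∃ i, K ≤ b i) ∨ ∃ i j : Fin N, (j : ℕ) = i + 1 ∧ K ≤ b i + b j) :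
    ∃ (v : ℕ) (β : Fin K → Fin N), (∀ j, (β j : ℕ) = v ∨ (β j : ℕ) = v + 1) ∧
      ∑ j, Finsupp.single (β j) 1 ≤ b := by
  rcases h with ⟨i, hi⟩ | ⟨i, i', hii', hi⟩
  · refine ⟨i, fun _ => i, fun _ => Or.inl rfl, ?_⟩
    simpa using hi
  -- The first `b i` slots take `e_i` (all of them if `b i ≥ K`), and the remaining ones take its
  -- neighbour.
  · refine ⟨i, fun j => if (j : ℕ) < b i then i else i', fun j => ?_, ?_⟩
    · dsimp only
      split_ifs
      · exact Or.inl rfl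
      · exact Or.inr hii'
    · have hne : i ≠ i' := by
        rintro rfl
        omega
      intro x
      rw [Finsupp.finsetSum_apply]
      simp only [Finsupp.single_apply, Finset.sum_boole, Nat.cast_id]
      have hc1 : (Finset.univ.filter fun j : Fin K => (j : ℕ) < b i).card = min K (b i) := by
        rw [Fin.card_filter_val_lt]
      have hc2 := Finset.card_filter_add_card_filter_not (s := (Finset.univ : Finset (Fin K)))
        (fun j : Fin K => (j : ℕ) < b i)
      rw [Finset.card_univ, Fintype.card_fin] at hc2
      by_cases hx : x = i
      · subst hx
        refine (Finset.card_le_card (t := Finset.univ.filter fun j : Fin K => (j : ℕ) < b x)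
          fun j hj => ?_).trans (by omega)
        simp only [Finset.mem_filter, Finset.mem_univ, true_and] at hj ⊢
        by_contra hlt
        rw [if_neg hlt] at hj
        exact hne hj.symm
      · by_cases hx' : x = i'
        · subst hx'
          refine (Finset.card_le_card (t := Finset.univ.filter fun j : Fin K => ¬ (j : ℕ) < b i)
            fun j hj => ?_).trans (by omega)
          simp only [Finset.mem_filter, Finset.mem_univ, true_and] at hj ⊢
          intro hlt
          rw [if_pos hlt] at hj
          exact hne hj
        · rw [Finset.card_eq_zero.2]
          · exact Nat.zero_le _
          · refine Finset.filter_false_of_mem fun j _ => ?_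
            split_ifs
            · exact fun h => hx h.symm
            · exact fun h => hx' h.symm

theorem mk_monomial_eq_zero {N K L R : ℕ} {b : Fin N →₀ ℕ} {i : Fin N} {n : ℕ} (hn : n ≤ b i)
    (hX : X i ^ n ∈ powIdeal N K L R) :
    Ideal.Quotient.mkₐ ℂ (powIdeal N K L R) (monomial b 1) = 0 := by
  refine Ideal.Quotient.eq_zero_iff_mem.2 (Ideal.mem_of_dvd _ ?_ hX)
  rw [monomial_one_eq_prod]
  exact (pow_dvd_pow _ hn).trans (Finset.dvd_prod_of_mem (fun i => X i ^ b i) (Finset.mem_univ i))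

/-- Bounds the convex weight in a fixed degree, so that straightening, which raises the weight,
terminates. -/
theorem sqWeight_le {N : ℕ} (b : Fin N →₀ ℕ) :
    sqWeight b ≤ N * (Finsupp.weight (bideg N) b).1 := by
  rw [sqWeight, Finsupp.weight_apply, Finsupp.weight_apply, Finsupp.sum_fintype _ _ (by simp),
    Finsupp.sum_fintype _ _ (by simp), Prod.fst_sum, Finset.mul_sum]
  refine Finset.sum_le_sum fun i _ => ?_
  simp only [Prod.smul_fst, bideg, smul_eq_mul]
  calc b i * ((i : ℕ) + 1) ^ 2 = ((i : ℕ) + 1) * (b i * ((i : ℕ) + 1)) := by ring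
    _ ≤ N * (b i * ((i : ℕ) + 1)) := Nat.mul_le_mul_right _ i.isLt

/-- A non-admissible monomial either contains a forbidden power of an end variable, hence is zero,
or is divisible by a product of `K` factors in at most two neighbouring variables. In the second
case the coefficient of `e(t)^K` in the degree of that product, times the cofactor, expresses it by
strictly heavier monomials of the same bidegree. -/
theorem mk_monomial_mem_span (N K L R : ℕ) (b : Fin N →₀ ℕ) :
    Ideal.Quotient.mkₐ ℂ (powIdeal N K L R) (monomial b 1) ∈
      Submodule.span ℂ (Set.range fun a : {a // IsAdmissible N K L R a ∧
        Finsupp.weight (bideg N) a = Finsupp.weight (bideg N) b} =>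
          Ideal.Quotient.mkₐ ℂ (powIdeal N K L R) (monomial a.1 1)) := by
  obtain ⟨n, hn⟩ : ∃ n, N * (Finsupp.weight (bideg N) b).1 - sqWeight b = n := ⟨_, rfl⟩
  induction n using Nat.strong_induction_on generalizing b with
  | _ n ih =>
  by_cases hadm : IsAdmissible N K L R b
  · exact Submodule.subset_span ⟨⟨b, hadm, rfl⟩, rfl⟩
  by_cases h3 : ∀ i : Fin N, (i : ℕ) = 0 → b i < L
  swap
  · push Not at h3
    obtain ⟨i, hi, hle⟩ := h3
    rw [mk_monomial_eq_zero hle (X_first_pow_mem _ _ _ i hi)]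
    exact zero_mem _
  by_cases h4 : ∀ i : Fin N, (i : ℕ) + 1 = N → b i < R
  swap
  · push Not at h4
    obtain ⟨i, hi, hle⟩ := h4
    rw [mk_monomial_eq_zero hle (X_last_pow_mem _ _ _ i hi)]
    exact zero_mem _
  have hbad : (∃ i, K ≤ b i) ∨ ∃ i j : Fin N, (j : ℕ) = i + 1 ∧ K ≤ b i + b j := by
    by_contra! hcon
    exact hadm ⟨hcon.1, hcon.2, h3, h4⟩
  obtain ⟨v, β, hβ, hle⟩ := exists_sum_single_le hbad
  set d := b - ∑ j, Finsupp.single (β j) 1 with hd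
  have hb : d + ∑ j, Finsupp.single (β j) 1 = b := tsub_add_cancel_of_le hle
  set s := ∑ j, ((β j : ℕ) + 1) with hs
  set T := Finset.univ.filter fun α : Fin K → Fin N => ∑ j, ((α j : ℕ) + 1) = s with hT
  have hrel : ∑ α ∈ T, Ideal.Quotient.mkₐ ℂ (powIdeal N K L R)
      (monomial (d + ∑ j, Finsupp.single (α j) 1) 1) = 0 := by
    have : monomial d 1 * currentCoeff N K s ∈ powIdeal N K L R :=
      Ideal.mul_mem_left _ _ (currentCoeff_mem _ _ _ _ _)
    rw [← Ideal.Quotient.eq_zero_iff_mem, currentCoeff, Finset.mul_sum, map_sum] at this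
    refine Eq.trans (Finset.sum_congr rfl fun α _ => ?_) this
    have hX : ∏ j, X (α j) = monomial (∑ j, Finsupp.single (α j) 1) (1 : ℂ) := by
      rw [monomial_sum_one]
      rfl
    rw [hX, monomial_mul, one_mul]
    rfl
  rw [← Finset.sum_filter_add_sum_filter_not T
    fun α => (∑ j, Finsupp.single (α j) 1 : Fin N →₀ ℕ) = ∑ j, Finsupp.single (β j) 1] at hrel
  have hsame : ∑ α ∈ T with (∑ j, Finsupp.single (α j) 1 : Fin N →₀ ℕ) =
      ∑ j, Finsupp.single (β j) 1, Ideal.Quotient.mkₐ ℂ (powIdeal N K L R)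
        (monomial (d + ∑ j, Finsupp.single (α j) 1) 1) =
      ((T.filter fun α => (∑ j, Finsupp.single (α j) 1 : Fin N →₀ ℕ) =
        ∑ j, Finsupp.single (β j) 1).card : ℂ) •
        Ideal.Quotient.mkₐ ℂ (powIdeal N K L R) (monomial b 1) := by
    rw [Finset.sum_congr rfl fun α hα => by rw [(Finset.mem_filter.1 hα).2, hb],
      Finset.sum_const, Nat.cast_smul_eq_nsmul]
  -- The coefficient of `e^b` in the relation is the number of tuples with the same product as `β`,
  -- which is positive and so invertible in `ℂ`.
  have hcard : ((T.filter fun α => (∑ j, Finsupp.single (α j) 1 : Fin N →₀ ℕ) =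
      ∑ j, Finsupp.single (β j) 1).card : ℂ) ≠ 0 := by
    rw [Nat.cast_ne_zero, Finset.card_ne_zero]
    exact ⟨β, Finset.mem_filter.2 ⟨Finset.mem_filter.2 ⟨Finset.mem_univ _, rfl⟩, rfl⟩⟩
  rw [hsame] at hrel
  rw [← Submodule.smul_mem_iff _ hcard, eq_neg_of_add_eq_zero_left hrel]
  refine Submodule.neg_mem _ (Submodule.sum_mem _ fun α hα => ?_)
  obtain ⟨hαT, hne⟩ := Finset.mem_filter.1 hα
  have hαs := (Finset.mem_filter.1 hαT).2
  have hlt := (sum_single_eq_or_sqWeight_lt hβ hαs).resolve_left hne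
  have hbi : Finsupp.weight (bideg N) (d + ∑ j, Finsupp.single (α j) 1) =
      Finsupp.weight (bideg N) b := by
    rw [← hb, map_add, map_add, weight_bideg_sum_single, weight_bideg_sum_single, hαs]
  have hsq : sqWeight b < sqWeight (d + ∑ j, Finsupp.single (α j) 1) := by
    rw [← hb, map_add, map_add]
    exact Nat.add_lt_add_left hlt _
  have hbound := sqWeight_le (d + ∑ j, Finsupp.single (α j) 1)
  have := ih _ ?_ (d + ∑ j, Finsupp.single (α j) 1) rfl
  · rwa [hbi] at this
  · rw [hbi] at hbound ⊢
    omega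

/-! ### The Hilbert polynomial as a sum over admissible exponents -/

theorem component_eq_span (N : ℕ) (k l r : ℤ) (p : ℕ × ℕ) :
    component N k l r p =
      Submodule.span ℂ (Set.range fun a : {a // IsAdmissible N (k + 1).toNat (l + 1).toNat
        (r + 1).toNat a ∧ Finsupp.weight (bideg N) a = p} =>
          Ideal.Quotient.mkₐ ℂ (relIdeal N k l r) (monomial a.1 1)) := by
  apply le_antisymm
  · rw [component, weightedHomogeneousSubmodule_eq_finsupp_supported]
    rw [Submodule.map_le_iff_le_comap]
    intro f hf
    rw [Submodule.mem_comap, f.as_sum, map_sum]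
    refine Submodule.sum_mem _ fun b hb => ?_
    have hbp : Finsupp.weight (bideg N) b = p := hf hb
    rw [← mul_one (coeff b f), ← smul_eq_mul, ← smul_monomial, map_smul]
    refine Submodule.smul_mem _ _ ?_
    have := mk_monomial_mem_span N (k + 1).toNat (l + 1).toNat (r + 1).toNat b
    rw [hbp] at this
    exact this
  · rw [Submodule.span_le]
    rintro _ ⟨a, rfl⟩
    exact Submodule.mem_map_of_mem
      ((mem_weightedHomogeneousSubmodule _ _ _ _).2
        (isWeightedHomogeneous_monomial _ _ _ a.2.2))

theorem finrank_component {N : ℕ} (hN : 1 ≤ N) (k l r : ℤ) (p : ℕ × ℕ) :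
    Module.finrank ℂ (component N k l r p) =
      ((finite_isAdmissible N (k + 1).toNat (l + 1).toNat (r + 1).toNat).toFinset.filter
        fun a => Finsupp.weight (bideg N) a = p).card := by
  classical
  rw [component_eq_span]
  have hfin : Finite {a // IsAdmissible N (k + 1).toNat (l + 1).toNat (r + 1).toNat a ∧
      Finsupp.weight (bideg N) a = p} :=
    ((finite_isAdmissible N (k + 1).toNat (l + 1).toNat (r + 1).toNat).subset
      fun a ha => ha.1).to_subtype
  have := Fintype.ofFinite {a // IsAdmissible N (k + 1).toNat (l + 1).toNat (r + 1).toNat a ∧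
      Finsupp.weight (bideg N) a = p}
  rw [finrank_span_eq_card]
  · refine Fintype.card_of_subtype _ fun a => ?_
    rw [Finset.mem_filter, Set.Finite.mem_toFinset]
    rfl
  · have hli := linearIndependent_mk_monomial hN (k + 1).toNat (l + 1).toNat (r + 1).toNat
    rw [← relIdeal_eq_powIdeal] at hli
    have hinj : Function.Injective fun a : {a // IsAdmissible N (k + 1).toNat (l + 1).toNat
        (r + 1).toNat a ∧ Finsupp.weight (bideg N) a = p} =>
          (⟨a.1, a.2.1⟩ : {a // IsAdmissible N (k + 1).toNat (l + 1).toNat (r + 1).toNat a}) :=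
      fun a b h => Subtype.ext (by simpa using h)
    have h3 := hli.comp _ hinj
    rw [Function.comp_def] at h3
    exact h3

theorem hilbertPoly_eq_sum {N : ℕ} (hN : 1 ≤ N) (k l r : ℤ) :
    hilbertPoly N k l r =
      ∑ a ∈ (finite_isAdmissible N (k + 1).toNat (l + 1).toNat (r + 1).toNat).toFinset,
        q ^ (Finsupp.weight (bideg N) a).1 * z ^ (Finsupp.weight (bideg N) a).2 := by
  rw [hilbertPoly, ← Finset.sum_fiberwise_of_maps_to (t := (finite_support N k l r).toFinset)
    (g := fun a => Finsupp.weight (bideg N) a)]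
  · refine Finset.sum_congr rfl fun p _ => ?_
    rw [finrank_component hN, Finset.sum_congr rfl fun a ha => by
      rw [(Finset.mem_filter.1 ha).2], Finset.sum_const, nsmul_eq_mul]
  · intro a ha
    rw [Set.Finite.mem_toFinset] at ha ⊢
    -- A zero component in the bidegree of `a` would leave no admissible exponent there, but `a` is
    -- one.
    intro hbot
    have h0 := finrank_component hN k l r (Finsupp.weight (bideg N) a)
    rw [hbot, finrank_bot, eq_comm, Finset.card_eq_zero] at h0
    refine Finset.notMem_empty a (h0 ▸ Finset.mem_filter.2 ⟨?_, rfl⟩)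
    exact (Set.Finite.mem_toFinset _).2 ha

/-! ### The recursion on the last exponent -/

/-- When the last exponent equals `ρ`, the condition on the last adjacent pair becomes the end
condition `a_{N-1} < K - ρ` for the truncated exponent. -/
theorem isAdmissible_succ_iff {n K L ρ : ℕ} (hn : 1 ≤ n) (a : Fin (n + 1) →₀ ℕ) :
    IsAdmissible (n + 1) K L (ρ + 1) a ↔ IsAdmissible (n + 1) K L ρ a ∨
      a (Fin.last n) = ρ ∧ IsAdmissible n K L (K - ρ)
        (Finsupp.equivFunOnFinite.symm fun i => a i.castSucc) := by
  have hlast : ∀ i : Fin (n + 1), (i : ℕ) + 1 = n + 1 ↔ i = Fin.last n := by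
    intro i
    rw [Fin.ext_iff, Fin.val_last]
    omega
  simp only [IsAdmissible, hlast, forall_eq, Finsupp.equivFunOnFinite_symm_apply_apply]
  constructor
  · rintro ⟨h1, h2, h3, h4⟩
    rcases Nat.lt_succ_iff_lt_or_eq.1 h4 with h | h
    · exact Or.inl ⟨h1, h2, h3, h⟩
    · refine Or.inr ⟨h, fun i => h1 _, fun i j hij => h2 _ _ (by simpa using hij),
        fun i hi => h3 _ (by simpa using hi), fun i hi => ?_⟩
      have := h2 i.castSucc (Fin.last n) (by simp [hi])
      omega
  · rintro (⟨h1, h2, h3, h4⟩ | ⟨h, h1, h2, h3, h4⟩)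
    · exact ⟨h1, h2, h3, by omega⟩
    -- The truncated exponent has a last entry, and it is below `K - ρ`; this forces `ρ < K`, the
    -- bound needed for the new last entry.
    · have hl := h4 ⟨n - 1, by omega⟩ (Nat.sub_add_cancel hn)
      refine ⟨fun i => ?_, fun i j hij => ?_, fun i hi => ?_, by omega⟩
      · induction i using Fin.lastCases with
        | last => omega
        | cast i => exact h1 i
      · induction i using Fin.lastCases with
        | last =>
          have := j.isLt
          rw [Fin.val_last] at hij
          omega
        | cast i =>
          induction j using Fin.lastCases with
          | last =>
            have := h4 i (by simpa using hij.symm)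
            omega
          | cast j => exact h2 i j (by simpa using hij)
      · induction i using Fin.lastCases with
        | last =>
          rw [Fin.val_last] at hi
          omega
        | cast i => exact h3 i (by simpa using hi)

theorem weight_bideg_eq_add {n : ℕ} (a : Fin (n + 1) →₀ ℕ) :
    Finsupp.weight (bideg (n + 1)) a =
      a (Fin.last n) • (n + 1, 1) +
        Finsupp.weight (bideg n) (Finsupp.equivFunOnFinite.symm fun i => a i.castSucc) := by
  rw [Finsupp.weight_apply, Finsupp.weight_apply, Finsupp.sum_fintype _ _ (by simp),
    Finsupp.sum_fintype _ _ (by simp), Fin.sum_univ_castSucc, add_comm]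
  simp [bideg]

theorem sum_isAdmissible_succ {n : ℕ} (hn : 1 ≤ n) (K L ρ : ℕ) :
    ∑ a ∈ (finite_isAdmissible (n + 1) K L (ρ + 1)).toFinset,
        q ^ (Finsupp.weight (bideg (n + 1)) a).1 * z ^ (Finsupp.weight (bideg (n + 1)) a).2 =
      ∑ a ∈ (finite_isAdmissible (n + 1) K L ρ).toFinset,
        q ^ (Finsupp.weight (bideg (n + 1)) a).1 * z ^ (Finsupp.weight (bideg (n + 1)) a).2 +
      (q ^ (n + 1) * z) ^ ρ * ∑ a ∈ (finite_isAdmissible n K L (K - ρ)).toFinset,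
        q ^ (Finsupp.weight (bideg n) a).1 * z ^ (Finsupp.weight (bideg n) a).2 := by
  classical
  let res : (Fin (n + 1) →₀ ℕ) → (Fin n →₀ ℕ) := fun a =>
    Finsupp.equivFunOnFinite.symm fun i => a i.castSucc
  let ext : (Fin n →₀ ℕ) → (Fin (n + 1) →₀ ℕ) := fun b =>
    Finsupp.equivFunOnFinite.symm (Fin.snoc (α := fun _ => ℕ) b ρ)
  have hres : ∀ b, res (ext b) = b := by
    intro b
    ext i
    simp [res, ext]
  have hext : ∀ b, ext b (Fin.last n) = ρ := by
    intro b
    simp [ext]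
  have hinj : Function.Injective ext := fun b b' h => by rw [← hres b, h, hres]
  have himg : (finite_isAdmissible (n + 1) K L (ρ + 1)).toFinset =
      (finite_isAdmissible (n + 1) K L ρ).toFinset ∪
        (finite_isAdmissible n K L (K - ρ)).toFinset.image ext := by
    ext a
    rw [Set.Finite.mem_toFinset, Finset.mem_union, Set.Finite.mem_toFinset, Finset.mem_image]
    refine (isAdmissible_succ_iff hn a).trans (or_congr Iff.rfl ⟨fun h => ?_, ?_⟩)
    · refine ⟨res a, (Set.Finite.mem_toFinset _).2 h.2, ?_⟩
      ext i
      induction i using Fin.lastCases with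
      | last => rw [hext, h.1]
      | cast i => simp [ext, res]
    · rintro ⟨b, hb, rfl⟩
      rw [Set.Finite.mem_toFinset] at hb
      refine ⟨hext b, ?_⟩
      have := hres b
      simp only [res] at this
      rw [this]
      exact hb
  rw [himg, Finset.sum_union, Finset.sum_image hinj.injOn, Finset.mul_sum]
  · congr 1
    refine Finset.sum_congr rfl fun b _ => ?_
    have := hres b
    simp only [res] at this
    rw [weight_bideg_eq_add, hext, this]
    simp only [Prod.fst_add, Prod.snd_add, Prod.smul_fst, Prod.smul_snd, smul_eq_mul, mul_one]
    ring
  · rw [Finset.disjoint_left]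
    intro a ha hb
    obtain ⟨b, -, rfl⟩ := Finset.mem_image.1 hb
    have := ((Set.Finite.mem_toFinset _).1 ha).2.2.2 (Fin.last n) rfl
    rw [hext] at this
    exact lt_irrefl _ this

end CoinvariantSpace

theorem corollary1 (N : ℕ) (k l r : ℤ) (hN : 2 ≤ N) (hl : -1 ≤ l) (hr : 0 ≤ r)
    (hrk : r ≤ k + 1) :
    CoinvariantSpace.hilbertPoly N k l r =
      CoinvariantSpace.hilbertPoly N k l (r - 1) +
        (CoinvariantSpace.q ^ N * CoinvariantSpace.z) ^ r.toNat *
          CoinvariantSpace.hilbertPoly (N - 1) k l (k - r) := by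
  obtain ⟨n, rfl⟩ : ∃ n, N = n + 1 := ⟨N - 1, by omega⟩
  rw [Nat.add_sub_cancel, CoinvariantSpace.hilbertPoly_eq_sum (by omega),
    CoinvariantSpace.hilbertPoly_eq_sum (by omega), CoinvariantSpace.hilbertPoly_eq_sum (by omega),
    show (r + 1).toNat = r.toNat + 1 by omega, show (r - 1 + 1).toNat = r.toNat by omega,
    show (k - r + 1).toNat = (k + 1).toNat - r.toNat by omega]
  exact CoinvariantSpace.sum_isAdmissible_succ (by omega) _ _ _
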